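/- For a Borel set $E\subset\mathbb R$ let the Fourier dimension $\dim_{\mathbb F}(E)$ be the supremum of all $\beta\in[0,1]$ for which there are a Borel probability measure $\mu$ on $\mathbb R$ with $\mu(E)=1$ and a constant $C\in(0,\infty)$ such that $|\hat\mu(\xi)|\le C(1+|\xi|)^{-\beta/2}$ for all $\xi\in\mathbb R$, where $\hat\mu(\xi)=\int e^{-2\pi i x\xi}\,d\mu(x)$ (and $\dim_{\mathbb F}(\emptyset)=0$). For positive integers $a,b,c,d$ with $a+b=c+d$, the equation $$a x_1+b x_2=c y_1+d y_2 \qquad (\ast)$$ is of genus one if no nonempty proper subfamily of the coefficients $a,b,-c,-d$ (counted with multiplicity) has sum zero; otherwise it is of genus two (and then $\{a,b\}=\{c,d\}$). A solution $(x_1,x_2,y_1,y_2)\in\mathbb R^4$ of $(\ast)$ is trivial if either $(\ast)$ is of genus one and $x_1=x_2=y_1=y_2$, or $(\ast)$ is of genus two and $(x_1,x_2)=(y_1,y_2)$ or $(x_1,x_2)=(y_2,y_1)$. All other solutions are nontrivial. **Theorem.** Let $E\subset[0,1]$ be a Borel set with $\dim_{\mathbb F}(E)>\tfrac12$. Then there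 exist positive integers $a,b,c,d$ with $a+b=c+d$ such that $(\ast)$ has a nontrivial solution with $x_1,x_2,y_1,y_2\in E$. -/

import Mathlib

open MeasureTheory Set

noncomputable section

namespace LinearEquation

/-- The Fourier transform `ξ ↦ ∫ exp (-2πi x ξ) dμ(x)` of a measure on the line. -/
def fourierMeasure (μ : Measure ℝ) (ξ : ℝ) : ℂ :=
  ∫ x : ℝ, Complex.exp (-(2 * (Real.pi : ℂ) * Complex.I * (x : ℂ) * (ξ : ℂ))) ∂μ

/-- The exponents `β ∈ [0, 1]` for which some Borel probability measure `μ` that gives full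
measure to `E` satisfies `|μ̂(ξ)| ≤ C (1 + |ξ|) ^ (-β / 2)` for all real `ξ`. -/
def decayExponents (E : Set ℝ) : Set ℝ :=
  {β : ℝ | 0 ≤ β ∧ β ≤ 1 ∧ ∃ μ : Measure ℝ, IsProbabilityMeasure μ ∧ μ Eᶜ = 0 ∧
    ∃ C : ℝ, 0 < C ∧ ∀ ξ : ℝ, ‖fourierMeasure μ ξ‖ ≤ C * (1 + |ξ|) ^ (-β / 2)}

/-- The Fourier dimension of a set `E ⊆ ℝ`. The set of exponents is bounded above by `1`, and it
is empty only for `E = ∅`, where the supremum is `0`. -/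
def fourierDim (E : Set ℝ) : ℝ := sSup (decayExponents E)

/-- The family of coefficients of `a x₁ + b x₂ + (-c) y₁ + (-d) y₂ = 0`. -/
def coeffs (a b c d : ℕ) : Fin 4 → ℤ := ![(a : ℤ), (b : ℤ), -(c : ℤ), -(d : ℤ)]

/-- The equation `a x₁ + b x₂ = c y₁ + d y₂` (with `a + b = c + d`) is of genus one: no nonempty
proper subfamily of the coefficients `a, b, -c, -d`, counted with multiplicity, sums to zero. -/
def IsGenusOne (a b c d : ℕ) : Prop :=
  ¬ ∃ T : Finset (Fin 4), T.Nonempty ∧ T ≠ Finset.univ ∧ ∑ i ∈ T, coeffs a b c d i = 0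

/-- Otherwise the equation is of genus two. -/
def IsGenusTwo (a b c d : ℕ) : Prop := ¬ IsGenusOne a b c d

/-- `(x₁, x₂, y₁, y₂)` is a solution of `a x₁ + b x₂ = c y₁ + d y₂`. -/
def IsSolution (a b c d : ℕ) (x₁ x₂ y₁ y₂ : ℝ) : Prop :=
  (a : ℝ) * x₁ + (b : ℝ) * x₂ = (c : ℝ) * y₁ + (d : ℝ) * y₂

/-- Trivial solutions: in genus one those with all four entries equal; in genus two those with
`(x₁, x₂) = (y₁, y₂)` or `(x₁, x₂) = (y₂, y₁)`. -/
def IsTrivial (a b c d : ℕ) (x₁ x₂ y₁ y₂ : ℝ) : Prop :=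
  (IsGenusOne a b c d ∧ x₁ = x₂ ∧ x₂ = y₁ ∧ y₁ = y₂) ∨
    (IsGenusTwo a b c d ∧ ((x₁ = y₁ ∧ x₂ = y₂) ∨ (x₁ = y₂ ∧ x₂ = y₁)))

/-- Nontrivial solutions: all the other solutions. -/
def IsNontrivialSolution (a b c d : ℕ) (x₁ x₂ y₁ y₂ : ℝ) : Prop :=
  IsSolution a b c d x₁ x₂ y₁ y₂ ∧ ¬ IsTrivial a b c d x₁ x₂ y₁ y₂

end LinearEquation

end

namespace LinearEquation

open scoped ENNReal

/-! Take `μ` on `E` with decay exponent `β > 1/2`. For `a, b ≥ M` the image of `μ × μ` under `(x, y)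
↦ a x + b y` has transform `μ̂(aξ) μ̂(bξ)`, whose square is at most a constant times `(1 + M|ξ|) ^
(-2β)`. As `2β > 1`, its integral is `O(1/M)`, so by Cauchy–Schwarz the image of a compact `L` with
mass above `1/2` has length at least a constant times `M` (`exists_sq_measure_le_volume_image`). The
`N` maps with coefficients `j, 5N - j`, `N ≤ j < 2N`, send `L ⊆ [0,1]²` into `[0, 5N]`, yet each
image has length of order `N`. For large `N` two images meet (`exists_common_value`), which gives a
solution. It is nontrivial because `L` avoids the diagonal and the equation has genus one. -/

/-! ### Square integrable transforms and length. -/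

/-- Parseval with a Gaussian regulariser: the factor in `ξ` justifies Fubini without any decay of
the transform. -/
theorem integral_gaussian_prod (σ : Measure ℝ) [IsProbabilityMeasure σ] {δ : ℝ} (hδ : 0 < δ) :
    ∫ p : ℝ × ℝ, ((δ⁻¹ * Real.exp (-Real.pi * (p.1 - p.2) ^ 2 / δ ^ 2) : ℝ) : ℂ) ∂(σ.prod σ) =
      ∫ ξ : ℝ, ((Real.exp (-(Real.pi * δ ^ 2) * ξ ^ 2) : ℝ) : ℂ) *
        (fourierMeasure σ ξ * (starRingEnd ℂ) (fourierMeasure σ ξ)) := by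
  have hb : 0 < Real.pi * δ ^ 2 := by positivity
  have hbc : 0 < ((Real.pi * δ ^ 2 : ℝ) : ℂ).re := by rwa [Complex.ofReal_re]
  set F : ℝ × ℝ → ℝ → ℂ := fun p ξ =>
    Complex.exp (Complex.I * ((-(2 * Real.pi * (p.1 - p.2)) : ℝ) : ℂ) * ξ) *
      Complex.exp (-((Real.pi * δ ^ 2 : ℝ) : ℂ) * (ξ : ℂ) ^ 2) with hF
  have hnorm : ∀ p ξ, ‖F p ξ‖ = Real.exp (-(Real.pi * δ ^ 2) * ξ ^ 2) := by
    intro p ξ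
    rw [hF]
    simp only [norm_mul, Complex.norm_exp]
    have h1 : (Complex.I * ((-(2 * Real.pi * (p.1 - p.2)) : ℝ) : ℂ) * ξ).re = 0 := by simp
    have h2 : (-((Real.pi * δ ^ 2 : ℝ) : ℂ) * (ξ : ℂ) ^ 2).re = -(Real.pi * δ ^ 2) * ξ ^ 2 := by
      norm_cast
    rw [h1, h2, Real.exp_zero, one_mul]
  have hcont : Continuous (Function.uncurry F) := by
    simp only [hF, Function.uncurry_def]
    fun_prop
  have hint : Integrable (Function.uncurry F) ((σ.prod σ).prod volume) := by
    refine Integrable.mono' (g := fun q => (1 : ℝ) * Real.exp (-(Real.pi * δ ^ 2) * q.2 ^ 2))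
      ((integrable_const (1 : ℝ)).mul_prod (integrable_exp_neg_mul_sq hb))
      hcont.aestronglyMeasurable (ae_of_all _ fun q => ?_)
    simp only [Function.uncurry_def, hnorm, one_mul, le_refl]
  have hswap := integral_integral_swap hint
  have hleft : ∀ p : ℝ × ℝ, ∫ ξ, F p ξ =
      ((δ⁻¹ * Real.exp (-Real.pi * (p.1 - p.2) ^ 2 / δ ^ 2) : ℝ) : ℂ) := by
    intro p
    rw [hF]
    simp only
    rw [fourierIntegral_gaussian hbc]
    have hπ := Real.pi_ne_zero
    have h1 : ((Real.pi : ℂ) / ((Real.pi * δ ^ 2 : ℝ) : ℂ)) ^ (1 / 2 : ℂ) = ((δ⁻¹ : ℝ) : ℂ) := by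
      rw [← Complex.ofReal_div, show (1 / 2 : ℂ) = ((1 / 2 : ℝ) : ℂ) by norm_num,
        ← Complex.ofReal_cpow (by positivity), ← Real.sqrt_eq_rpow]
      congr 1
      rw [show Real.pi / (Real.pi * δ ^ 2) = (δ⁻¹) ^ 2 by field_simp]
      exact Real.sqrt_sq (by positivity)
    have h2 : -((-(2 * Real.pi * (p.1 - p.2)) : ℝ) : ℂ) ^ 2 / (4 * ((Real.pi * δ ^ 2 : ℝ) : ℂ)) =
        ((-(-(2 * Real.pi * (p.1 - p.2))) ^ 2 / (4 * (Real.pi * δ ^ 2)) : ℝ) : ℂ) := by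
      push_cast; rfl
    rw [h1, h2, ← Complex.ofReal_exp, ← Complex.ofReal_mul]
    congr 3
    field_simp
    ring
  have hright : ∀ ξ : ℝ, ∫ p, F p ξ ∂(σ.prod σ) =
      ((Real.exp (-(Real.pi * δ ^ 2) * ξ ^ 2) : ℝ) : ℂ) *
        (fourierMeasure σ ξ * (starRingEnd ℂ) (fourierMeasure σ ξ)) := by
    intro ξ
    rw [hF]
    simp only
    rw [integral_mul_const, mul_comm]
    congr 1
    · push_cast; rfl
    · rw [fourierMeasure, ← integral_conj, ← integral_prod_mul]
      refine integral_congr_ae (ae_of_all _ fun p => ?_)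
      simp only
      rw [← Complex.exp_conj, ← Complex.exp_add]
      congr 1
      simp only [map_neg, map_mul, Complex.conj_I, Complex.conj_ofReal, map_ofNat]
      push_cast
      ring
  simp_rw [hleft, hright] at hswap
  exact hswap

theorem lintegral_gaussian_prod_le (σ : Measure ℝ) [IsProbabilityMeasure σ] {δ : ℝ} (hδ : 0 < δ) :
    ∫⁻ p : ℝ × ℝ, ENNReal.ofReal (Real.exp (-Real.pi * (p.1 - p.2) ^ 2 / δ ^ 2)) ∂(σ.prod σ) ≤
      ENNReal.ofReal δ * ∫⁻ ξ : ℝ, ‖fourierMeasure σ ξ‖ₑ ^ 2 := by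
  have h := integral_gaussian_prod σ hδ
  rw [integral_complex_ofReal, integral_const_mul] at h
  have hint : Integrable (fun p : ℝ × ℝ => Real.exp (-Real.pi * (p.1 - p.2) ^ 2 / δ ^ 2))
      (σ.prod σ) := by
    refine Integrable.mono' (integrable_const (1 : ℝ))
      (by fun_prop : Continuous _).aestronglyMeasurable (ae_of_all _ fun p => ?_)
    rw [Real.norm_eq_abs, Real.abs_exp, Real.exp_le_one_iff]
    apply div_nonpos_of_nonpos_of_nonneg _ (sq_nonneg _)
    nlinarith [Real.pi_pos, mul_nonneg Real.pi_pos.le (sq_nonneg (p.1 - p.2))]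
  have h0 := ofReal_integral_eq_lintegral_ofReal hint (ae_of_all _ fun p => (Real.exp_pos _).le)
  rw [← h0]
  set A := ∫ p : ℝ × ℝ, Real.exp (-Real.pi * (p.1 - p.2) ^ 2 / δ ^ 2) ∂(σ.prod σ)
  have hA : 0 ≤ A := integral_nonneg fun p => (Real.exp_pos _).le
  have h2 : ENNReal.ofReal (δ⁻¹ * A) ≤ ∫⁻ ξ : ℝ, ‖fourierMeasure σ ξ‖ₑ ^ 2 := by
    have h3 : ENNReal.ofReal (δ⁻¹ * A) = ‖((δ⁻¹ * A : ℝ) : ℂ)‖ₑ := by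
      rw [← ofReal_norm, Complex.norm_real, Real.norm_of_nonneg (by positivity)]
    rw [h3, h]
    refine (enorm_integral_le_lintegral_enorm _).trans (lintegral_mono fun ξ => ?_)
    rw [enorm_mul, enorm_mul, RCLike.enorm_conj, ← sq]
    refine mul_le_of_le_one_left' ?_
    rw [← ofReal_norm, Complex.norm_real, Real.norm_eq_abs, Real.abs_exp, ← ENNReal.ofReal_one]
    refine ENNReal.ofReal_le_ofReal (Real.exp_le_one_iff.2 ?_)
    nlinarith [mul_nonneg (mul_nonneg Real.pi_pos.le (sq_nonneg δ)) (sq_nonneg ξ)]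
  calc ENNReal.ofReal A = ENNReal.ofReal δ * ENNReal.ofReal (δ⁻¹ * A) := by
        rw [← ENNReal.ofReal_mul hδ.le, mul_inv_cancel_left₀ hδ.ne']
    _ ≤ _ := by gcongr

/-- By Fubini a pair of points counts for length at most `2δ`, and only if it is `2δ`-close; there
the Gaussian is at least `exp (-4π)`. -/
theorem lintegral_sq_measure_closedBall_le (σ : Measure ℝ) [IsProbabilityMeasure σ] {δ : ℝ}
    (hδ : 0 < δ) :
    ∫⁻ t : ℝ, σ (Metric.closedBall t δ) ^ 2 ≤ ENNReal.ofReal (2 * δ ^ 2) *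
      (ENNReal.ofReal (Real.exp (4 * Real.pi)) * ∫⁻ ξ : ℝ, ‖fourierMeasure σ ξ‖ₑ ^ 2) := by
  set S : Set (ℝ × ℝ × ℝ) := {q | |q.2.1 - q.1| ≤ δ ∧ |q.2.2 - q.1| ≤ δ} with hS
  have hSm : MeasurableSet S := by
    apply IsClosed.measurableSet
    apply IsClosed.and
    · exact isClosed_le (by fun_prop) (by fun_prop)
    · exact isClosed_le (by fun_prop) (by fun_prop)
  have h1 : ∀ t : ℝ, σ (Metric.closedBall t δ) ^ 2 =
      ∫⁻ p : ℝ × ℝ, S.indicator 1 (t, p) ∂(σ.prod σ) := by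
    intro t
    rw [sq, ← Measure.prod_prod, ← lintegral_indicator_one
      (Metric.isClosed_closedBall.measurableSet.prod Metric.isClosed_closedBall.measurableSet)]
    rfl
  simp_rw [h1]
  rw [lintegral_lintegral_swap (f := fun t p => S.indicator (1 : ℝ × ℝ × ℝ → ℝ≥0∞) (t, p))
    (measurable_one.indicator hSm).aemeasurable]
  have h2 : ∀ p : ℝ × ℝ, ∫⁻ t : ℝ, S.indicator (1 : ℝ × ℝ × ℝ → ℝ≥0∞) (t, p) ≤
      ENNReal.ofReal (2 * δ) * (ENNReal.ofReal (Real.exp (4 * Real.pi)) *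
        ENNReal.ofReal (Real.exp (-Real.pi * (p.1 - p.2) ^ 2 / δ ^ 2))) := by
    intro p
    by_cases hp : |p.1 - p.2| ≤ 2 * δ
    · have h3 : ∫⁻ t : ℝ, S.indicator (1 : ℝ × ℝ × ℝ → ℝ≥0∞) (t, p) ≤ ENNReal.ofReal (2 * δ) := by
        rw [← Real.volume_closedBall p.1 δ,
          ← lintegral_indicator_one Metric.isClosed_closedBall.measurableSet]
        refine lintegral_mono fun t => ?_
        by_cases h : (t, p) ∈ S
        · have : t ∈ Metric.closedBall p.1 δ := by
            rw [Metric.mem_closedBall, Real.dist_eq, abs_sub_comm]; exact h.1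
          simp [this, h]
        · simp [h]
      refine h3.trans ?_
      refine le_mul_of_one_le_right' ?_
      rw [← ENNReal.ofReal_mul (Real.exp_pos _).le, ← Real.exp_add, ENNReal.one_le_ofReal,
        Real.one_le_exp_iff]
      have h4 : (p.1 - p.2) ^ 2 ≤ (2 * δ) ^ 2 := sq_le_sq' (by linarith [neg_le_of_abs_le hp])
        (le_of_abs_le hp)
      have h5 : Real.pi * (p.1 - p.2) ^ 2 / δ ^ 2 ≤ 4 * Real.pi := by
        rw [div_le_iff₀ (by positivity)]
        nlinarith [mul_le_mul_of_nonneg_left h4 Real.pi_pos.le]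
      have h6 : -Real.pi * (p.1 - p.2) ^ 2 / δ ^ 2 = -(Real.pi * (p.1 - p.2) ^ 2 / δ ^ 2) := by
        ring
      linarith
    · have : ∀ t : ℝ, (t, p) ∉ S := by
        rintro t ⟨ha, hb⟩
        apply hp
        calc |p.1 - p.2| = |(p.1 - t) - (p.2 - t)| := by ring_nf
          _ ≤ |p.1 - t| + |p.2 - t| := abs_sub _ _
          _ ≤ 2 * δ := by simp only at ha hb; linarith
      simp [this]
  refine (lintegral_mono h2).trans ?_
  rw [lintegral_const_mul' _ _ ENNReal.ofReal_ne_top,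
    lintegral_const_mul' _ _ ENNReal.ofReal_ne_top]
  calc _ ≤ ENNReal.ofReal (2 * δ) * (ENNReal.ofReal (Real.exp (4 * Real.pi)) *
        (ENNReal.ofReal δ * ∫⁻ ξ : ℝ, ‖fourierMeasure σ ξ‖ₑ ^ 2)) := by
        gcongr
        exact lintegral_gaussian_prod_le σ hδ
    _ = _ := by
        rw [show 2 * δ ^ 2 = 2 * δ * δ by ring, ENNReal.ofReal_mul (by positivity : 0 ≤ 2 * δ)]
        ring

/-- By Fubini: each `x ∈ K` lies in the balls centred at the points of an interval of length `2δ`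
inside the thickening. -/
theorem measure_mul_le_setLIntegral_closedBall (σ : Measure ℝ) [IsProbabilityMeasure σ] {δ : ℝ}
    {K : Set ℝ} (hK : IsClosed K) :
    σ K * ENNReal.ofReal (2 * δ) ≤
      ∫⁻ t in Metric.cthickening δ K, σ (Metric.closedBall t δ) := by
  set S : Set (ℝ × ℝ) := {q | |q.2 - q.1| ≤ δ} with hS
  have hSm : MeasurableSet S :=
    (isClosed_le (by fun_prop) (by fun_prop) : IsClosed S).measurableSet
  have h1 : ∀ t : ℝ, σ (Metric.closedBall t δ) = ∫⁻ x : ℝ, S.indicator 1 (t, x) ∂σ := by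
    intro t
    rw [← lintegral_indicator_one Metric.isClosed_closedBall.measurableSet]
    rfl
  simp_rw [h1]
  rw [lintegral_lintegral_swap (f := fun t x => S.indicator (1 : ℝ × ℝ → ℝ≥0∞) (t, x))
    (measurable_one.indicator hSm).aemeasurable]
  rw [mul_comm, ← setLIntegral_const]
  refine (setLIntegral_mono' hK.measurableSet fun x hx => ?_).trans (setLIntegral_le_lintegral K _)
  rw [← Real.volume_closedBall x δ,
    ← lintegral_indicator_one Metric.isClosed_closedBall.measurableSet,
    ← lintegral_indicator Metric.isClosed_cthickening.measurableSet]
  refine lintegral_mono fun t => ?_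
  by_cases h : t ∈ Metric.closedBall x δ
  · have h2 : t ∈ Metric.cthickening δ K := Metric.mem_cthickening_of_dist_le t x δ K hx h
    have h3 : (t, x) ∈ S := by
      rw [Metric.mem_closedBall, Real.dist_eq, abs_sub_comm] at h; exact h
    simp [h, h2, h3]
  · simp [h]

theorem sq_lintegral_le {f : ℝ → ℝ≥0∞} (hf : AEMeasurable f) (A : Set ℝ) :
    (∫⁻ t in A, f t) ^ 2 ≤ volume A * ∫⁻ t, f t ^ 2 := by
  have h := ENNReal.lintegral_mul_le_Lp_mul_Lq (volume.restrict A) Real.HolderConjugate.two_two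
    (aemeasurable_const (b := (1 : ℝ≥0∞))) hf.restrict
  simp only [Pi.mul_apply, one_mul, ENNReal.one_rpow, lintegral_const, Measure.restrict_apply_univ]
    at h
  calc (∫⁻ t in A, f t) ^ 2 ≤ (volume A ^ (1 / 2 : ℝ) *
        (∫⁻ t in A, f t ^ (2 : ℝ)) ^ (1 / 2 : ℝ)) ^ 2 := by gcongr
    _ = volume A * ∫⁻ t in A, f t ^ 2 := by
        rw [mul_pow, ← ENNReal.rpow_natCast, ← ENNReal.rpow_natCast, ← ENNReal.rpow_mul,
          ← ENNReal.rpow_mul]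
        norm_num
    _ ≤ _ := by gcongr; exact Measure.restrict_le_self

/-- A measure with square integrable Fourier transform charges only sets of positive length,
quantitatively. -/
theorem sq_measure_le_volume_mul (σ : Measure ℝ) [IsProbabilityMeasure σ] {K : Set ℝ}
    (hK : IsCompact K) {J : ℝ≥0∞} (hJ : J ≠ ∞) (hσ : ∫⁻ ξ : ℝ, ‖fourierMeasure σ ξ‖ₑ ^ 2 ≤ J) :
    σ K ^ 2 ≤ volume K * (ENNReal.ofReal (Real.exp (4 * Real.pi)) * J) := by
  -- Both sides of the Cauchy–Schwarz bound scale as `δ ^ 2`, so `δ` survives only in the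
  -- thickening, which shrinks to `K`.
  have key : ∀ δ : ℝ, 0 < δ → σ K ^ 2 ≤ volume (Metric.cthickening δ K) *
      (ENNReal.ofReal (Real.exp (4 * Real.pi)) * J) := by
    intro δ hδ
    have hmeas : Measurable fun t : ℝ => σ (Metric.closedBall t δ) := by
      have hSm : MeasurableSet {q : ℝ × ℝ | |q.2 - q.1| ≤ δ} :=
        (isClosed_le (by fun_prop) (by fun_prop) : IsClosed _).measurableSet
      exact measurable_measure_prodMk_left hSm
    have h1 := measure_mul_le_setLIntegral_closedBall σ (δ := δ) hK.isClosed
    have h2 := sq_lintegral_le hmeas.aemeasurable (Metric.cthickening δ K)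
    have h3 := lintegral_sq_measure_closedBall_le σ hδ
    have h4 : ENNReal.ofReal (2 * δ ^ 2) * σ K ^ 2 ≤ ENNReal.ofReal (2 * δ ^ 2) *
        (volume (Metric.cthickening δ K) * (ENNReal.ofReal (Real.exp (4 * Real.pi)) * J)) := by
      calc _ ≤ ENNReal.ofReal ((2 * δ) ^ 2) * σ K ^ 2 := by
            gcongr; nlinarith
        _ = (σ K * ENNReal.ofReal (2 * δ)) ^ 2 := by
            rw [mul_pow (σ K), ENNReal.ofReal_pow (by positivity), mul_comm]
        _ ≤ volume (Metric.cthickening δ K) * (ENNReal.ofReal (2 * δ ^ 2) *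
              (ENNReal.ofReal (Real.exp (4 * Real.pi)) * J)) := by
            refine (pow_le_pow_left' h1 2).trans (h2.trans ?_)
            gcongr
            refine h3.trans ?_
            gcongr
        _ = _ := by ring
    have hpos : ENNReal.ofReal (2 * δ ^ 2) ≠ 0 := by
      rw [Ne, ENNReal.ofReal_eq_zero, not_le]; positivity
    exact (ENNReal.mul_le_mul_iff_right hpos ENNReal.ofReal_ne_top).1 h4
  have hlim := (tendsto_measure_cthickening_of_isCompact (μ := volume) hK).mono_left
    (nhdsWithin_le_nhds (s := Ioi (0 : ℝ)))
  have hlim2 := ENNReal.Tendsto.mul_const (b := ENNReal.ofReal (Real.exp (4 * Real.pi)) * J) hlim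
    (Or.inr (ENNReal.mul_ne_top ENNReal.ofReal_ne_top hJ))
  exact ge_of_tendsto hlim2 (Filter.eventually_of_mem self_mem_nhdsWithin fun δ hδ => key δ hδ)

/-! ### Linear images of the product measure. -/

theorem fourierMeasure_map_linear (μ : Measure ℝ) [IsProbabilityMeasure μ] (a b ξ : ℝ) :
    fourierMeasure ((μ.prod μ).map fun p : ℝ × ℝ => a * p.1 + b * p.2) ξ =
      fourierMeasure μ (a * ξ) * fourierMeasure μ (b * ξ) := by
  rw [fourierMeasure, integral_map (by fun_prop)
    (by fun_prop : Continuous _).aestronglyMeasurable, fourierMeasure, fourierMeasure,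
    ← integral_prod_mul]
  refine integral_congr_ae (ae_of_all _ fun p => ?_)
  simp only
  rw [← Complex.exp_add]
  congr 1
  push_cast
  ring

theorem norm_fourierMeasure_map_linear_le {μ : Measure ℝ} [IsProbabilityMeasure μ] {β C : ℝ}
    (hβ : 0 ≤ β) (hC : 0 < C)
    (hμ : ∀ ξ : ℝ, ‖fourierMeasure μ ξ‖ ≤ C * (1 + |ξ|) ^ (-β / 2))
    {M a b : ℝ} (hM : 0 < M) (ha : M ≤ a) (hb : M ≤ b) (ξ : ℝ) :
    ‖fourierMeasure ((μ.prod μ).map fun p : ℝ × ℝ => a * p.1 + b * p.2) ξ‖ ^ 2 ≤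
      C ^ 4 * (1 + |M * ξ|) ^ (-(2 * β)) := by
  have hpos : 0 < 1 + |M * ξ| := by positivity
  have hle : ∀ c : ℝ, M ≤ c → ‖fourierMeasure μ (c * ξ)‖ ≤ C * (1 + |M * ξ|) ^ (-β / 2) := by
    intro c hc
    refine (hμ _).trans ?_
    gcongr ?_ * ?_
    refine Real.rpow_le_rpow_of_nonpos hpos ?_ (by linarith)
    rw [abs_mul, abs_mul, abs_of_pos hM, abs_of_pos (hM.trans_le hc)]
    gcongr
  rw [fourierMeasure_map_linear, norm_mul]
  calc (‖fourierMeasure μ (a * ξ)‖ * ‖fourierMeasure μ (b * ξ)‖) ^ 2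
      ≤ ((C * (1 + |M * ξ|) ^ (-β / 2)) * (C * (1 + |M * ξ|) ^ (-β / 2))) ^ 2 := by
        gcongr
        · exact hle a ha
        · exact hle b hb
    _ = C ^ 4 * ((1 + |M * ξ|) ^ (-β / 2)) ^ 4 := by ring
    _ = _ := by
        rw [← Real.rpow_natCast ((1 + |M * ξ|) ^ (-β / 2)), ← Real.rpow_mul hpos.le]
        congr 2
        push_cast
        ring

/-- Images of compact sets of positive `μ × μ` measure under `(x, y) ↦ a x + b y` have large
length, uniformly in the coefficients. -/
theorem exists_sq_measure_le_volume_image {μ : Measure ℝ} [IsProbabilityMeasure μ] {β C : ℝ}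
    (hβ : 1 / 2 < β) (hC : 0 < C)
    (hμ : ∀ ξ : ℝ, ‖fourierMeasure μ ξ‖ ≤ C * (1 + |ξ|) ^ (-β / 2)) :
    ∃ D : ℝ, 0 ≤ D ∧ ∀ M a b : ℝ, 0 < M → M ≤ a → M ≤ b → ∀ L : Set (ℝ × ℝ), IsCompact L →
      (μ.prod μ) L ^ 2 ≤
        volume ((fun p : ℝ × ℝ => a * p.1 + b * p.2) '' L) * ENNReal.ofReal (D / M) := by
  -- The threshold `1/2` enters here: the exponent `2β` must exceed the dimension `1`.
  have hI : Integrable fun x : ℝ => (1 + |x|) ^ (-(2 * β)) :=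
    integrable_one_add_norm (E := ℝ) (by rw [Module.finrank_self]; push_cast; linarith)
  refine ⟨Real.exp (4 * Real.pi) * (C ^ 4 * ∫ x : ℝ, (1 + |x|) ^ (-(2 * β))), ?_, ?_⟩
  · have : 0 ≤ ∫ x : ℝ, (1 + |x|) ^ (-(2 * β)) := integral_nonneg fun x => by positivity
    positivity
  intro M a b hM ha hb L hL
  set ℓ : ℝ × ℝ → ℝ := fun p => a * p.1 + b * p.2 with hℓ
  have hℓc : Continuous ℓ := by fun_prop
  have : IsProbabilityMeasure ((μ.prod μ).map ℓ) :=
    Measure.isProbabilityMeasure_map hℓc.aemeasurable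
  have hσ : ∫⁻ ξ : ℝ, ‖fourierMeasure ((μ.prod μ).map ℓ) ξ‖ₑ ^ 2 ≤
      ENNReal.ofReal ((C ^ 4 * ∫ x : ℝ, (1 + |x|) ^ (-(2 * β))) / M) := by
    have h1 : Integrable fun x : ℝ => C ^ 4 * (1 + |M * x|) ^ (-(2 * β)) :=
      (hI.comp_mul_left' hM.ne').const_mul _
    have h2 : ∫ x : ℝ, C ^ 4 * (1 + |M * x|) ^ (-(2 * β)) =
        (C ^ 4 * ∫ x : ℝ, (1 + |x|) ^ (-(2 * β))) / M := by
      rw [integral_const_mul, Measure.integral_comp_mul_left (fun x => (1 + |x|) ^ (-(2 * β))),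
        abs_of_pos (inv_pos.2 hM), smul_eq_mul]
      ring
    rw [← h2, ofReal_integral_eq_lintegral_ofReal h1 (ae_of_all _ fun x => by positivity)]
    refine lintegral_mono fun ξ => ?_
    simp only
    rw [← ofReal_norm, ← ENNReal.ofReal_pow (norm_nonneg _)]
    exact ENNReal.ofReal_le_ofReal
      (norm_fourierMeasure_map_linear_le (by linarith) hC hμ hM ha hb ξ)
  have h := sq_measure_le_volume_mul _ (hL.image hℓc) ENNReal.ofReal_ne_top hσ
  rw [← ENNReal.ofReal_mul (Real.exp_pos _).le, ← mul_div_assoc] at h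
  refine le_trans ?_ h
  gcongr
  rw [Measure.map_apply hℓc.measurable (hL.image hℓc).isClosed.measurableSet]
  exact measure_mono (subset_preimage_image ℓ L)

/-! ### Nontriviality and pigeonhole. -/

theorem exists_isCompact_offDiag {μ : Measure ℝ} [IsProbabilityMeasure μ] {β C : ℝ}
    (hβ : 1 / 2 < β) (hC : 0 < C)
    (hμ : ∀ ξ : ℝ, ‖fourierMeasure μ ξ‖ ≤ C * (1 + |ξ|) ^ (-β / 2))
    {E : Set ℝ} (hE : MeasurableSet E) (hμE : μ Eᶜ = 0) :
    ∃ L ⊆ (E ×ˢ E) \ diagonal ℝ, IsCompact L ∧ 1 / 2 < (μ.prod μ) L := by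
  obtain ⟨D, -, hD⟩ := exists_sq_measure_le_volume_image hβ hC hμ
  have hatom : ∀ x : ℝ, μ {x} = 0 := by
    intro x
    -- The image of a point has length zero, so `μ` has no atoms.
    have h := hD 1 1 1 one_pos le_rfl le_rfl {(x, x)} isCompact_singleton
    rw [image_singleton, Real.volume_singleton, zero_mul, ← singleton_prod_singleton,
      Measure.prod_prod] at h
    simpa using h
  have hdiag : (μ.prod μ) (diagonal ℝ) = 0 := by
    rw [Measure.measure_prod_null measurableSet_diagonal]
    refine ae_of_all _ fun x => ?_
    have : Prod.mk x ⁻¹' diagonal ℝ = {x} := by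
      ext y; simp [eq_comm]
    simp [this, hatom]
  have hE1 : μ E = 1 := (prob_compl_eq_zero_iff hE).1 hμE
  have hone : (μ.prod μ) ((E ×ˢ E) \ diagonal ℝ) = 1 := by
    rw [measure_sdiff_null hdiag, Measure.prod_prod, hE1, one_mul]
  apply MeasurableSet.exists_lt_isCompact ((hE.prod hE).diff measurableSet_diagonal)
  rw [hone]
  simp

/-- The coefficients total zero, so three of them sum to minus the fourth, which is nonzero. Among
pairs, only `j = k` and `j = n - k` could cancel; the latter fails since `j + k < n`. -/
theorem isGenusOne_of_lt {n j k : ℕ} (hj : 0 < j) (hk : 0 < k) (hj2 : 2 * j < n) (hk2 : 2 * k < n)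
    (hjk : j ≠ k) : IsGenusOne j (n - j) k (n - k) := by
  rintro ⟨T, hT, hTu, hsum⟩
  have hmem : ∑ i ∈ T, coeffs j (n - j) k (n - k) i =
      ∑ i, if i ∈ T then coeffs j (n - j) k (n - k) i else 0 := by
    rw [Finset.sum_ite_mem, Finset.univ_inter]
  rw [hmem, Fin.sum_univ_four] at hsum
  have hne : ¬ (0 ∈ T ∧ 1 ∈ T ∧ 2 ∈ T ∧ 3 ∈ T) := by
    rintro ⟨h0, h1, h2, h3⟩
    apply hTu
    ext i
    fin_cases i <;> simp_all
  have hex : 0 ∈ T ∨ 1 ∈ T ∨ 2 ∈ T ∨ 3 ∈ T := by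
    obtain ⟨i, hi⟩ := hT
    fin_cases i <;> simp_all
  simp only [coeffs, Matrix.cons_val] at hsum
  split_ifs at hsum <;> first | tauto | omega

/-- Two distinct integers `j`, `k` in `[N, 2N)` such that `(x, y) ↦ j x + (5N - j) y` and
`(x, y) ↦ k x + (5N - k) y` take a common value on a given large compact set. -/
theorem exists_common_value {μ : Measure ℝ} [IsProbabilityMeasure μ] {β C : ℝ}
    (hβ : 1 / 2 < β) (hC : 0 < C)
    (hμ : ∀ ξ : ℝ, ‖fourierMeasure μ ξ‖ ≤ C * (1 + |ξ|) ^ (-β / 2))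
    {L : Set (ℝ × ℝ)} (hL : IsCompact L) (hL01 : L ⊆ Icc 0 1 ×ˢ Icc 0 1)
    (hμL : 1 / 2 < (μ.prod μ) L) :
    ∃ N : ℕ, 0 < N ∧ ∃ j ∈ Finset.Ico N (2 * N), ∃ k ∈ Finset.Ico N (2 * N), j ≠ k ∧
      ∃ p ∈ L, ∃ q ∈ L,
        (j : ℝ) * p.1 + (5 * N - j : ℝ) * p.2 = (k : ℝ) * q.1 + (5 * N - k : ℝ) * q.2 := by
  obtain ⟨D, hD0, hD⟩ := exists_sq_measure_le_volume_image hβ hC hμ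
  -- Disjoint images, each of length `ℓ` with `N / 4 ≤ D * ℓ`, inside `[0, 5N]` would force `N * (N
  -- / 4) ≤ 5 * N * D`, that is `N ≤ 20 * D`.
  obtain ⟨N, hN⟩ := exists_nat_gt (20 * D)
  have hN0 : (0 : ℝ) < N := by linarith
  refine ⟨N, by exact_mod_cast hN0, ?_⟩
  by_contra! hcon
  set K : ℕ → Set ℝ := fun j => (fun p : ℝ × ℝ => (j : ℝ) * p.1 + (5 * N - j : ℝ) * p.2) '' L
    with hK
  have hKc : ∀ j, IsCompact (K j) := fun j => hL.image (by fun_prop)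
  have hdisj : ((Finset.Ico N (2 * N) : Finset ℕ) : Set ℕ).PairwiseDisjoint K := by
    intro j hj k hk hjk
    rw [Function.onFun, Set.disjoint_left]
    rintro _ ⟨p, hp, rfl⟩ ⟨q, hq, hqe⟩
    exact hcon j hj k hk hjk p hp q hq hqe.symm
  have hreal : ∀ j ∈ Finset.Ico N (2 * N), (N : ℝ) ≤ (j : ℝ) ∧ (j : ℝ) ≤ 2 * N := by
    intro j hj
    rw [Finset.mem_Ico] at hj
    exact ⟨by exact_mod_cast hj.1, by exact_mod_cast hj.2.le⟩
  have hvol : ∀ j ∈ Finset.Ico N (2 * N), (N : ℝ) / 4 ≤ D * volume.real (K j) := by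
    intro j hj
    obtain ⟨h1, h2⟩ := hreal j hj
    have h := hD N j (5 * N - j) hN0 h1 (by linarith) L hL
    have h3 : ENNReal.ofReal (1 / 4) ≤ volume (K j) * ENNReal.ofReal (D / N) := by
      refine le_trans ?_ h
      rw [show (1 / 4 : ℝ) = (1 / 2) ^ 2 by norm_num, ENNReal.ofReal_pow (by norm_num)]
      gcongr
      rw [ENNReal.ofReal_div_of_pos (by norm_num)]
      simpa using hμL.le
    rw [← ofReal_measureReal (hKc j).measure_lt_top.ne, ← ENNReal.ofReal_mul measureReal_nonneg,
      ENNReal.ofReal_le_ofReal_iff (by positivity), ← mul_div_assoc, le_div_iff₀ hN0] at h3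
    linarith
  have hsub : ⋃ j ∈ Finset.Ico N (2 * N), K j ⊆ Icc 0 (5 * N : ℝ) := by
    refine iUnion₂_subset fun j hj => ?_
    obtain ⟨h1, h2⟩ := hreal j hj
    rintro _ ⟨p, hp, rfl⟩
    obtain ⟨⟨h3, h4⟩, h5, h6⟩ := hL01 hp
    have h7 : (0 : ℝ) ≤ 5 * N - j := by linarith
    constructor
    · positivity
    · nlinarith [mul_le_mul_of_nonneg_left h4 (by linarith : (0 : ℝ) ≤ j),
        mul_le_mul_of_nonneg_left h6 h7]
  have hsum : ∑ j ∈ Finset.Ico N (2 * N), volume.real (K j) ≤ 5 * N := by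
    rw [← measureReal_biUnion_finset hdisj (fun j _ => (hKc j).isClosed.measurableSet)
      (fun j _ => (hKc j).measure_lt_top.ne)]
    refine (measureReal_mono hsub measure_Icc_lt_top.ne).trans ?_
    rw [Real.volume_real_Icc_of_le (by positivity), sub_zero]
  have hlow := Finset.sum_le_sum hvol
  rw [Finset.sum_const, Nat.card_Ico, ← Finset.mul_sum, nsmul_eq_mul,
    show 2 * N - N = N by omega] at hlow
  nlinarith [mul_le_mul_of_nonneg_left hsum hD0]

end LinearEquation

theorem theorem1 (E : Set ℝ) (hE : MeasurableSet E) (hE01 : E ⊆ Set.Icc (0 : ℝ) 1)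
    (hdim : (1 / 2 : ℝ) < LinearEquation.fourierDim E) :
    ∃ a b c d : ℕ, 0 < a ∧ 0 < b ∧ 0 < c ∧ 0 < d ∧ a + b = c + d ∧
      ∃ x₁ ∈ E, ∃ x₂ ∈ E, ∃ y₁ ∈ E, ∃ y₂ ∈ E,
        LinearEquation.IsNontrivialSolution a b c d x₁ x₂ y₁ y₂ := by
  have hne : (LinearEquation.decayExponents E).Nonempty := by
    by_contra h
    rw [Set.not_nonempty_iff_eq_empty] at h
    rw [LinearEquation.fourierDim, h, Real.sSup_empty] at hdim
    norm_num at hdim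
  obtain ⟨β, ⟨-, -, μ, _, hμE, C, hC, hμ⟩, hβ⟩ := exists_lt_of_lt_csSup hne hdim
  obtain ⟨L, hLE, hL, hμL⟩ := LinearEquation.exists_isCompact_offDiag hβ hC hμ hE hμE
  obtain ⟨N, hN, j, hj, k, hk, hjk, p, hp, q, hq, hpq⟩ :=
    LinearEquation.exists_common_value hβ hC hμ hL
      (fun p hp => ⟨hE01 (hLE hp).1.1, hE01 (hLE hp).1.2⟩) hμL
  rw [Finset.mem_Ico] at hj hk
  refine ⟨j, 5 * N - j, k, 5 * N - k, by omega, by omega, by omega, by omega, by omega,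
    p.1, (hLE hp).1.1, p.2, (hLE hp).1.2, q.1, (hLE hq).1.1, q.2, (hLE hq).1.2, ?_, ?_⟩
  · rw [LinearEquation.IsSolution, Nat.cast_sub (by omega), Nat.cast_sub (by omega)]
    push_cast
    exact hpq
  · have hgenus : LinearEquation.IsGenusOne j (5 * N - j) k (5 * N - k) :=
      LinearEquation.isGenusOne_of_lt (by omega) (by omega) (by omega) (by omega) hjk
    -- A trivial solution of genus one would put `p` on the diagonal.
    rintro (⟨-, h, -⟩ | ⟨h, -⟩)
    · exact (hLE hp).2 h
    · exact h hgenus
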